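/- **Theorem 6.1.** Let $(\Omega,\mathcal F,\mathbb P)$ be a probability space, $H$ a separable real Hilbert space, $x_0,z\in H$, $(y_n)_{n\in\mathbb N}$ a sequence of $H$-valued random variables, $(a_n)$ a sequence of nonnegative reals, and $$x_{n+1}:=x_n-a_ny_n\qquad(n\in\mathbb N).$$ Let $L>0$ with $\|x_0-z\|^2<L$, and let $\mathcal F_n:=\sigma(x_0,y_0,\dots,x_{n-1},y_{n-1})$ (the trivial $\sigma$-algebra for $n=0$). Call $f:[0,\infty)\to[0,\infty)$ *s.i.c.c. with moduli* $\psi:[0,1]\to[0,1]$ *and* $\kappa:(0,\infty)\to(0,\infty)$ if $f$ is strictly increasing, concave and continuous, $f(0)=0$, $f(xa)\ge f(x)\psi(a)$ for all $x\ge 0$ and $a\in[0,1]$, $\psi(a)>0$ for $a>0$, and $f(x)<\varepsilon$ whenever $\varepsilon>0$ and $0\le x<\kappa(\varepsilon)$. Suppose that: 1. there are $c,d>0$ and nonnegative random variables $(d_n)$ with $\sup_n\mathbb E[d_n]\le d$ such that, for all $n$, $\mathbb E[\|y_n\|^2\mid\mathcal F_n]\le c\|x_n-z\|^2+d_n$ a.s.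 (the left-hand side being the conditional expectation of a nonnegative random variable, a priori with values in $[0,\infty]$); 2. $\langle x_n-z,\mathbb E[y_n\mid\mathcal F_n]\rangle\ge 0$ a.s. for all $n$; 3. $f$ is s.i.c.c. with moduli $\psi$ and $\kappa$, and $\tau:(0,\infty)\to(0,\infty)$ is such that, for all $\varepsilon>0$ and $n\in\mathbb N$, $\mathbb E[\langle x_n-z,\mathbb E[y_n\mid\mathcal F_n]\rangle]<\tau(\varepsilon)$ implies $\mathbb E[f(\|x_n-z\|^2)]<\varepsilon$; 4. $\theta:\mathbb N\times(0,\infty)\to\mathbb N$, $\chi:(0,\infty)\to\mathbb N$ and $M$ are such that $\sum_{n=k}^{\theta(k,b)}a_n\ge b$, $\sum_{n=0}^\infty a_n^2<M$ and $\sum_{n=\chi(\varepsilon)}^\infty a_n^2<\varepsilon$ for all $\varepsilon,b>0$ and $k\in\mathbb N$. Put $K_1:=\tfrac12\psi(e^{-cM})$, $K_2:=e^{cM}(L+dM)$ and $$\rho(\varepsilon):=\theta\left(\chi\left(\frac{\kappa(K_1\varepsilon)}{d}\right),\frac{K_2}{\tau(K_1\varepsilon)}\right).$$ Then each $f(\|x_n-z\|^2)$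 is integrable, $\mathbb E[f(\|x_n-z\|^2)]\to0$ with rate $\rho$, i.e. $$\forall\varepsilon>0\ \forall n\ge\rho(\varepsilon)\quad \mathbb E[f(\|x_n-z\|^2)]<\varepsilon,$$ and $x_n\to z$ a.s. with rate $\rho'(\lambda,\varepsilon):=\rho(\lambda f(\varepsilon^2))$, i.e. $$\forall\lambda,\varepsilon>0\quad \mathbb P\bigl(\exists n\ge\rho'(\lambda,\varepsilon)\ \ \|x_n-z\|\ge\varepsilon\bigr)<\lambda.$$ -/

import Mathlib

open MeasureTheory Filter Topology

/-- `f : [0,∞) → [0,∞)` is s.i.c.c. (supermultiplicative, increasing, concave, continuous) with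
moduli `ψ : [0,1] → [0,1]` and `κ : (0,∞) → (0,∞)`. The functions are total functions on `ℝ`
constrained only on their mathematical domains. -/
structure IsSICC (f ψ κ : ℝ → ℝ) : Prop where
  nonneg : ∀ x, 0 ≤ x → 0 ≤ f x
  psi_mem : ∀ a ∈ Set.Icc (0 : ℝ) 1, ψ a ∈ Set.Icc (0 : ℝ) 1
  psi_pos : ∀ a ∈ Set.Ioc (0 : ℝ) 1, 0 < ψ a
  supermul : ∀ x, 0 ≤ x → ∀ a ∈ Set.Icc (0 : ℝ) 1, f x * ψ a ≤ f (x * a)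
  strictMonoOn : StrictMonoOn f (Set.Ici 0)
  concaveOn : ConcaveOn ℝ (Set.Ici 0) f
  continuousOn : ContinuousOn f (Set.Ici 0)
  map_zero : f 0 = 0
  kappa_pos : ∀ ε, 0 < ε → 0 < κ ε
  kappa_spec : ∀ ε, 0 < ε → ∀ x, 0 ≤ x → x < κ ε → f x < ε

/-- The `σ`-algebra generated by `x 0, y 0, …, x (n - 1), y (n - 1)` (trivial for `n = 0`). -/
@[reducible] def rmSigma {Ω H : Type*} [MeasurableSpace H] (x y : ℕ → Ω → H) (n : ℕ) : MeasurableSpace Ω :=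
  ⨆ i ∈ Finset.range n,
    (MeasurableSpace.comap (x i) inferInstance ⊔ MeasurableSpace.comap (y i) inferInstance)

/-- The rate `ρ ε = θ (χ (κ (K₁ ε) / d), K₂ / τ (K₁ ε))` with `K₁ = ψ (e^{-cM}) / 2` and
`K₂ = e^{cM} (L + d M)`. -/
noncomputable def rmRate (θ : ℕ → ℝ → ℕ) (χ : ℝ → ℕ) (τ ψ κ : ℝ → ℝ) (c d L M : ℝ)
    (ε : ℝ) : ℕ :=
  let K₁ : ℝ := 1 / 2 * ψ (Real.exp (-(c * M)))
  let K₂ : ℝ := Real.exp (c * M) * (L + d * M)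
  θ (χ (κ (K₁ * ε) / d)) (K₂ / τ (K₁ * ε))

/-! ### Nonnegative concave functions on the half-line -/

section Concave

variable {φ : ℝ → ℝ}

/-! Write X_n = ‖x_n - z‖². Expanding the square and conditioning gives E[X_{n+1} | F_n] ≤ (1 + c
a_n²) X_n - 2 a_n ⟨x_n - z, E[y_n | F_n]⟩ + a_n² E[D_n | F_n] (`condExp_sq_norm_sub_smul_le`), which
is used twice. In mean, a discrete Gronwall argument bounds ∑ a_n v_n by K₂, where v_n is the mean
of the inner product. Divergence of ∑ a_n, quantified by θ, then yields an index m between k and the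
rate ρ(ε) with v_m < τ(K₁ε), hence E f(X_m) < K₁ε. Conditionally, with P_n = ∏_{i<n} (1 + c a_i²),
the process W_n = X_n / P_n is a supermartingale up to the errors a_n² D_n. Adding the conditional
expectation of the future errors makes it a supermartingale, and f preserves this by Jensen. The
mean at time m is at most E f(W_m) + f(β), with β = d ∑_{n≥k} a_n², and k is chosen so that f(β) <
K₁ε. Since ψ(e^{-cM}) f(X_n) ≤ f(W_n), smallness at the one time m persists for all n ≥ m in mean,
and uniformly in n by Ville's inequality (`almost_supermartingale_concave_bounds`). -/

theorem ConcaveOn.mul_le_map_mul (hφ : ConcaveOn ℝ (Set.Ici 0) φ) (h0 : 0 ≤ φ 0)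
    {s t : ℝ} (hs : 0 ≤ s) (ht : 0 ≤ t) (ht1 : t ≤ 1) : t * φ s ≤ φ (t * s) := by
  have h := hφ.2 (Set.mem_Ici.2 hs) (Set.mem_Ici.2 le_rfl) ht (sub_nonneg.2 ht1)
    (add_sub_cancel t 1)
  simp only [smul_eq_mul, mul_zero, add_zero] at h
  have : 0 ≤ (1 - t) * φ 0 := mul_nonneg (sub_nonneg.2 ht1) h0
  linarith

theorem ConcaveOn.map_add_le_add (hφ : ConcaveOn ℝ (Set.Ici 0) φ) (h0 : 0 ≤ φ 0)
    {x y : ℝ} (hx : 0 ≤ x) (hy : 0 ≤ y) : φ (x + y) ≤ φ x + φ y := by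
  rcases (add_nonneg hx hy).eq_or_lt with h | h
  · have hx0 : x = 0 := by linarith
    have hy0 : y = 0 := by linarith
    subst hx0 hy0
    simpa using h0
  · have h1 := hφ.mul_le_map_mul h0 h.le (t := x / (x + y)) (by positivity)
      (by rw [div_le_one h]; linarith)
    have h2 := hφ.mul_le_map_mul h0 h.le (t := y / (x + y)) (by positivity)
      (by rw [div_le_one h]; linarith)
    rw [div_mul_cancel₀ _ h.ne'] at h1 h2
    have : x / (x + y) * φ (x + y) + y / (x + y) * φ (x + y) = φ (x + y) := by
      field_simp
    linarith

/-- Concavity forces at most linear growth, so `φ` maps integrable variables to integrable ones. -/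
theorem ConcaveOn.map_le_mul_one_add_abs (hφ : ConcaveOn ℝ (Set.Ici 0) φ) (hm : Monotone φ)
    (h0 : 0 ≤ φ 0) (x : ℝ) : φ x ≤ φ 1 * (1 + |x|) := by
  have h1 : 0 ≤ φ 1 := h0.trans (hm zero_le_one)
  rcases le_total x 1 with h | h
  · have := hm h
    nlinarith [abs_nonneg x, mul_nonneg h1 (abs_nonneg x)]
  · have hx : 0 < x := by linarith
    have := hφ.mul_le_map_mul h0 hx.le (t := x⁻¹) (by positivity) (inv_le_one_of_one_le₀ h)
    rw [inv_mul_cancel₀ hx.ne', inv_mul_le_iff₀ hx] at this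
    rw [abs_of_pos hx]
    nlinarith

end Concave

/-! ### Concave functions of almost supermartingales and a maximal inequality -/

section Probability

variable {Ω : Type*} {m0 : MeasurableSpace Ω} {μ : Measure Ω} {φ : ℝ → ℝ}

theorem MeasureTheory.Integrable.concave_comp [IsFiniteMeasure μ] (hφ : ConcaveOn ℝ (Set.Ici 0) φ)
    (hm : Monotone φ) (hc : Continuous φ) (h0 : ∀ x, 0 ≤ φ x) {U : Ω → ℝ} (hU : Integrable U μ) :
    Integrable (fun ω => φ (U ω)) μ := by
  refine Integrable.mono' (g := fun ω => φ 1 * (1 + |U ω|))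
    (((integrable_const 1).add hU.abs).const_mul _)
    (hc.comp_aestronglyMeasurable hU.aestronglyMeasurable) (ae_of_all _ fun ω => ?_)
  rw [Real.norm_of_nonneg (h0 _)]
  exact hφ.map_le_mul_one_add_abs hm (h0 0) _

/-- Conditional Jensen followed by monotonicity of `φ`. The set-integral form is exactly what the
stopping argument in Ville's inequality consumes. -/
theorem setIntegral_concave_comp_le [IsFiniteMeasure μ] (hφ : ConcaveOn ℝ (Set.Ici 0) φ)
    (hmono : Monotone φ) (hc : Continuous φ) (h0 : ∀ x, 0 ≤ φ x)
    {m : MeasurableSpace Ω} (hm : m ≤ m0) {U V : Ω → ℝ} (hU : Integrable U μ) (hV : Integrable V μ)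
    (hV0 : 0 ≤ᵐ[μ] V) (hVU : μ[V | m] ≤ᵐ[μ] U) {s : Set Ω} (hs : MeasurableSet[m] s) :
    ∫ ω in s, φ (V ω) ∂μ ≤ ∫ ω in s, φ (U ω) ∂μ := by
  have hφV := hV.concave_comp hφ hmono hc h0
  have hJ : μ[φ ∘ V | m] ≤ᵐ[μ] φ ∘ μ[V | m] :=
    hφ.condExp_map_le hm (hc.upperSemicontinuous.upperSemicontinuousOn _) hV0 isClosed_Ici hV hφV
  calc ∫ ω in s, φ (V ω) ∂μ = ∫ ω in s, (μ[φ ∘ V | m]) ω ∂μ :=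
        (setIntegral_condExp hm hφV hs).symm
    _ ≤ ∫ ω in s, φ (U ω) ∂μ := by
        refine setIntegral_mono_ae integrable_condExp.integrableOn
          (hU.concave_comp hφ hmono hc h0).integrableOn ?_
        filter_upwards [hJ, hVU] with ω h1 h2
        exact h1.trans (hmono h2)

/-- Ville's maximal inequality for a nonnegative process that has the supermartingale property on
`0, …, K`. -/
theorem mul_measureReal_exists_le [IsFiniteMeasure μ] (ℱ : ℕ → MeasurableSpace Ω)
    (hℱ : Monotone ℱ) (hle : ∀ n, ℱ n ≤ m0) {Y : ℕ → Ω → ℝ} (K : ℕ)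
    (hmeas : ∀ n ≤ K, Measurable[ℱ n] (Y n)) (hint : ∀ n ≤ K, Integrable (Y n) μ)
    (hnonneg : ∀ n ≤ K, ∀ ω, 0 ≤ Y n ω)
    (hstep : ∀ n < K, ∀ s, MeasurableSet[ℱ n] s → ∫ ω in s, Y (n + 1) ω ∂μ ≤ ∫ ω in s, Y n ω ∂μ)
    (c : ℝ) : c * μ.real {ω | ∃ n ≤ K, c ≤ Y n ω} ≤ ∫ ω, Y 0 ω ∂μ := by
  have hset : ∀ k ≤ K, MeasurableSet[ℱ k] {ω | ∃ n ≤ k, c ≤ Y n ω} := by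
    intro k hk
    have : {ω | ∃ n ≤ k, c ≤ Y n ω} = ⋃ n ∈ Set.Iic k, {ω | c ≤ Y n ω} := by
      ext ω; simp
    rw [this]
    refine MeasurableSet.biUnion (Set.to_countable _) fun n hn => ?_
    exact hℱ hn _ (hmeas n (le_trans hn hk) measurableSet_Ici)
  have hbound : ∀ {k}, k ≤ K → ∀ {s : Set Ω}, MeasurableSet s → (∀ ω ∈ s, c ≤ Y k ω) →
      c * μ.real s ≤ ∫ ω in s, Y k ω ∂μ := by
    intro k hk s hs h
    have := setIntegral_mono_on (integrable_const c).integrableOn (hint k hk).integrableOn hs h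
    simpa [mul_comm] using this
  -- The left side is nonincreasing in `k`: paths that have reached level `c` are frozen at the
  -- value `c`, the others keep running.
  have key : ∀ k ≤ K, c * μ.real {ω | ∃ n ≤ k, c ≤ Y n ω}
      + ∫ ω in {ω | ∃ n ≤ k, c ≤ Y n ω}ᶜ, Y k ω ∂μ ≤ ∫ ω, Y 0 ω ∂μ := by
    intro k
    induction k with
    | zero =>
      intro hk
      have hs := hle 0 _ (hset 0 hk)
      rw [← integral_add_compl hs (hint 0 hk)]
      gcongr
      refine hbound hk hs fun ω hω => ?_
      obtain ⟨n, hn, h⟩ := hω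
      rwa [Nat.le_zero.1 hn] at h
    | succ k ih =>
      intro hk
      have hk' : k ≤ K := (Nat.le_succ k).trans hk
      refine le_trans ?_ (ih hk')
      set s := {ω | ∃ n ≤ k, c ≤ Y n ω} with hs_def
      set s' := {ω | ∃ n ≤ k + 1, c ≤ Y n ω} with hs'_def
      have hs := hset k hk'
      have hs' := hle _ _ (hset (k + 1) hk)
      have hsub : s ⊆ s' := fun ω ⟨n, hn, h⟩ => ⟨n, hn.trans (Nat.le_succ k), h⟩
      have hdiff : MeasurableSet (s' \ s) := hs'.diff (hle _ _ hs)
      have h1 : μ.real s' = μ.real s + μ.real (s' \ s) := by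
        rw [← measureReal_union Set.disjoint_sdiff_right hdiff, Set.union_sdiff_cancel hsub]
      have h2 : ∫ ω in sᶜ, Y (k + 1) ω ∂μ
          = ∫ ω in s' \ s, Y (k + 1) ω ∂μ + ∫ ω in s'ᶜ, Y (k + 1) ω ∂μ := by
        rw [← setIntegral_union ?_ hs'.compl (hint _ hk).integrableOn (hint _ hk).integrableOn]
        · congr 2
          ext ω
          have := @hsub ω
          simp only [Set.mem_compl_iff, Set.mem_union, Set.mem_sdiff]
          tauto
        · exact disjoint_compl_right.mono_left Set.sdiff_subset
      have h3 : c * μ.real (s' \ s) ≤ ∫ ω in s' \ s, Y (k + 1) ω ∂μ := by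
        refine hbound hk hdiff fun ω hω => ?_
        obtain ⟨⟨n, hn, h⟩, hns⟩ := hω
        rcases Nat.le_succ_iff.1 hn with hn' | hn'
        · exact absurd ⟨n, hn', h⟩ hns
        · rwa [hn'] at h
      have h4 := hstep k hk sᶜ hs.compl
      rw [h1, mul_add]
      linarith
  refine le_trans ?_ (key K le_rfl)
  have : 0 ≤ ∫ ω in {ω | ∃ n ≤ K, c ≤ Y n ω}ᶜ, Y K ω ∂μ :=
    integral_nonneg fun ω => hnonneg K le_rfl ω
  linarith

/-- If `W` is an almost supermartingale with errors `B`, then `φ ∘ W` is dominated by a process with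
the supermartingale property on `m, …, N` whose initial mean is controlled. -/
theorem exists_dominating_supermartingale [IsProbabilityMeasure μ]
    (hφ : ConcaveOn ℝ (Set.Ici 0) φ) (hmono : Monotone φ) (hc : Continuous φ)
    (h0 : ∀ x, 0 ≤ φ x) (ℱ : ℕ → MeasurableSpace Ω) (hℱ : Monotone ℱ) (hle : ∀ n, ℱ n ≤ m0)
    {W B : ℕ → Ω → ℝ} (hWm : ∀ n, StronglyMeasurable[ℱ n] (W n)) (hWi : ∀ n, Integrable (W n) μ)
    (hW0 : ∀ n ω, 0 ≤ W n ω) (hBi : ∀ n, Integrable (B n) μ) (hB0 : ∀ n, 0 ≤ᵐ[μ] B n)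
    (hstep : ∀ n, μ[W (n + 1) | ℱ n] ≤ᵐ[μ] W n + μ[B n | ℱ n]) (m N : ℕ) {β : ℝ}
    (hβ : ∑ i ∈ Finset.Ico m N, ∫ ω, B i ω ∂μ ≤ β) :
    ∃ Y : ℕ → Ω → ℝ, (∀ n, Measurable[ℱ n] (Y n)) ∧ (∀ n, Integrable (Y n) μ) ∧
      (∀ n ω, 0 ≤ Y n ω) ∧
      (∀ n < N, ∀ s, MeasurableSet[ℱ n] s → ∫ ω in s, Y (n + 1) ω ∂μ ≤ ∫ ω in s, Y n ω ∂μ) ∧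
      (∀ n, (fun ω => φ (W n ω)) ≤ᵐ[μ] Y n) ∧ ∫ ω, Y m ω ∂μ ≤ ∫ ω, φ (W m ω) ∂μ + φ β := by
  -- Errors still to come before the finite horizon `N`. The drop from `R n` to `R (n + 1)` pays for
  -- the error `B n` of that step.
  set R : ℕ → Ω → ℝ := fun n => ∑ i ∈ Finset.Ico n N, B i with hR
  have hRi : ∀ n, Integrable (R n) μ := fun n => integrable_finsetSum' _ fun i _ => hBi i
  have hR0 : ∀ n, 0 ≤ᵐ[μ] R n := by
    intro n
    filter_upwards [ae_all_iff.2 hB0] with ω h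
    simpa [hR] using Finset.sum_nonneg fun i _ => h i
  have hE0 : ∀ n, 0 ≤ᵐ[μ] μ[R n | ℱ n] := fun n => condExp_nonneg (hR0 n)
  set U : ℕ → Ω → ℝ := fun n => W n + μ[R n | ℱ n] with hU
  have hUi : ∀ n, Integrable (U n) μ := fun n => (hWi n).add integrable_condExp
  have hU0 : ∀ n, 0 ≤ᵐ[μ] U n := by
    intro n
    filter_upwards [hE0 n] with ω h
    exact add_nonneg (hW0 n ω) h
  have hUm : ∀ n, StronglyMeasurable[ℱ n] (U n) := fun n =>
    (hWm n).add stronglyMeasurable_condExp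
  have hUstep : ∀ n < N, μ[U (n + 1) | ℱ n] ≤ᵐ[μ] U n := by
    intro n hn
    have hRn : R n = B n + R (n + 1) := by
      simp only [hR]
      rw [Finset.sum_eq_sum_Ico_succ_bot hn]
    have e1 := condExp_add (m := ℱ n) (hWi (n + 1))
      (integrable_condExp (m := ℱ (n + 1)) (f := R (n + 1)) (μ := μ))
    have e2 := condExp_condExp_of_le (f := R (n + 1)) (μ := μ) (hℱ (Nat.le_succ n)) (hle (n + 1))
    have e3 := condExp_add (m := ℱ n) (hBi n) (hRi (n + 1))
    rw [← hRn] at e3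
    filter_upwards [e1, e2, e3, hstep n] with ω h1 h2 h3 h4
    simp only [hU, Pi.add_apply] at h1 h2 h3 h4 ⊢
    rw [h1, h2, h3]
    linarith
  refine ⟨fun n ω => φ (U n ω), fun n => ?_, fun n => (hUi n).concave_comp hφ hmono hc h0,
    fun n ω => h0 _, fun n hn s hs => ?_, fun n => ?_, ?_⟩
  · exact hc.measurable.comp (hUm n).measurable
  · exact setIntegral_concave_comp_le hφ hmono hc h0 (hle n) (hUi n) (hUi _) (hU0 _)
      (hUstep n hn) hs
  · filter_upwards [hE0 n] with ω h
    exact hmono (le_add_of_nonneg_right h)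
  · have hEi : Integrable (μ[R m | ℱ m]) μ := integrable_condExp
    have hφE := hEi.concave_comp hφ hmono hc h0
    have hφW := (hWi m).concave_comp hφ hmono hc h0
    have hJ : ∫ ω, φ ((μ[R m | ℱ m]) ω) ∂μ ≤ φ (∫ ω, (μ[R m | ℱ m]) ω ∂μ) :=
      hφ.le_map_integral hc.continuousOn isClosed_Ici (hE0 m) hEi hφE
    have hRint : ∫ ω, (μ[R m | ℱ m]) ω ∂μ ≤ β := by
      rw [integral_condExp (hle m)]
      refine le_trans (le_of_eq ?_) hβ
      simp only [hR, Finset.sum_apply]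
      exact integral_finsetSum _ fun i _ => hBi i
    calc ∫ ω, φ (U m ω) ∂μ
        ≤ ∫ ω, (φ (W m ω) + φ ((μ[R m | ℱ m]) ω)) ∂μ := by
          refine integral_mono_ae ((hUi m).concave_comp hφ hmono hc h0) (hφW.add hφE) ?_
          filter_upwards [hE0 m] with ω h
          -- Subadditivity separates the present value from the future errors; Jensen then handles
          -- the errors alone.
          exact hφ.map_add_le_add (h0 0) (hW0 m ω) h
      _ = ∫ ω, φ (W m ω) ∂μ + ∫ ω, φ ((μ[R m | ℱ m]) ω) ∂μ := integral_add hφW hφE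
      _ ≤ _ := by
          gcongr
          exact hJ.trans (hmono hRint)

/-- Mean and maximal bounds for a concave function of an almost supermartingale. -/
theorem almost_supermartingale_concave_bounds [IsProbabilityMeasure μ]
    (hφ : ConcaveOn ℝ (Set.Ici 0) φ) (hmono : Monotone φ) (hc : Continuous φ)
    (h0 : ∀ x, 0 ≤ φ x) (ℱ : ℕ → MeasurableSpace Ω) (hℱ : Monotone ℱ) (hle : ∀ n, ℱ n ≤ m0)
    {W B : ℕ → Ω → ℝ} (hWm : ∀ n, StronglyMeasurable[ℱ n] (W n)) (hWi : ∀ n, Integrable (W n) μ)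
    (hW0 : ∀ n ω, 0 ≤ W n ω) (hBi : ∀ n, Integrable (B n) μ) (hB0 : ∀ n, 0 ≤ᵐ[μ] B n)
    (hstep : ∀ n, μ[W (n + 1) | ℱ n] ≤ᵐ[μ] W n + μ[B n | ℱ n]) (m : ℕ) {β : ℝ}
    (hβ : ∀ N, ∑ i ∈ Finset.Ico m N, ∫ ω, B i ω ∂μ ≤ β) :
    (∀ n, m ≤ n → ∫ ω, φ (W n ω) ∂μ ≤ ∫ ω, φ (W m ω) ∂μ + φ β) ∧
    ∀ c, 0 ≤ c → c * μ.real {ω | ∃ n, m ≤ n ∧ c ≤ φ (W n ω)} ≤ ∫ ω, φ (W m ω) ∂μ + φ β := by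
  have hφW := fun n => (hWi n).concave_comp hφ hmono hc h0
  refine ⟨fun n hn => ?_, fun c hc0 => ?_⟩
  · obtain ⟨Y, -, hYi, -, hYs, hWY, hYm⟩ := exists_dominating_supermartingale hφ hmono hc h0 ℱ hℱ
      hle hWm hWi hW0 hBi hB0 hstep m n (hβ n)
    have hdec : ∀ k, m ≤ k → k ≤ n → ∫ ω, Y k ω ∂μ ≤ ∫ ω, Y m ω ∂μ := by
      intro k hk
      induction k, hk using Nat.le_induction with
      | base => exact fun _ => le_rfl
      | succ k _ ih =>
        intro hkn
        have := hYs k hkn Set.univ MeasurableSet.univ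
        simp only [setIntegral_univ] at this
        exact this.trans (ih (Nat.le_of_succ_le hkn))
    exact (integral_mono_ae (hφW n) (hYi n) (hWY n)).trans ((hdec n hn le_rfl).trans hYm)
  · have hfin : ∀ K, c * μ.real {ω | ∃ n ≤ K, c ≤ φ (W (m + n) ω)}
        ≤ ∫ ω, φ (W m ω) ∂μ + φ β := by
      intro K
      obtain ⟨Y, hYmeas, hYi, hY0, hYs, hWY, hYm⟩ := exists_dominating_supermartingale hφ hmono hc
        h0 ℱ hℱ hle hWm hWi hW0 hBi hB0 hstep m (m + K) (hβ (m + K))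
      have hV := mul_measureReal_exists_le (μ := μ) (fun n => ℱ (m + n))
        (fun i j hij => hℱ (Nat.add_le_add_left hij m)) (fun n => hle _) (Y := fun n => Y (m + n)) K
        (fun n _ => hYmeas _) (fun n _ => hYi _) (fun n _ => hY0 _)
        (fun n hn s hs => hYs (m + n) (Nat.add_lt_add_left hn m) s hs) c
      refine le_trans ?_ (hV.trans hYm)
      gcongr ?_ * ?_
      refine ENNReal.toReal_mono (measure_ne_top _ _) (measure_mono_ae ?_)
      filter_upwards [ae_all_iff.2 hWY] with ω h
      rintro ⟨n, hn, h'⟩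
      exact ⟨n, hn, h'.trans (h _)⟩
    have hmonoS : Monotone fun K : ℕ => {ω | ∃ n ≤ K, c ≤ φ (W (m + n) ω)} :=
      fun i j hij ω ⟨n, hn, h⟩ => ⟨n, hn.trans hij, h⟩
    have hU : {ω | ∃ n, m ≤ n ∧ c ≤ φ (W n ω)}
        = ⋃ K : ℕ, {ω | ∃ n ≤ K, c ≤ φ (W (m + n) ω)} := by
      ext ω
      simp only [Set.mem_ofPred_eq, Set.mem_iUnion]
      constructor
      · rintro ⟨n, hn, h⟩
        exact ⟨n - m, n - m, le_rfl, by rwa [Nat.add_sub_cancel' hn]⟩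
      · rintro ⟨K, n, -, h⟩
        exact ⟨m + n, Nat.le_add_right _ _, h⟩
    rw [hU]
    have hlim := tendsto_measure_iUnion_atTop (μ := μ) hmonoS
    have hlim' := ((ENNReal.tendsto_toReal (measure_ne_top μ _)).comp hlim).const_mul c
    exact le_of_tendsto' hlim' hfin

end Probability

/-! ### The extension of a modulus function by zero -/

namespace IsSICC

variable {f ψ κ : ℝ → ℝ}

/-- The probabilistic lemmas require `φ` monotone and continuous on all of `ℝ`, while `f` is
controlled only on the half-line; hence `t ↦ f (max t 0)`. -/
theorem monotone_comp_max (hf : IsSICC f ψ κ) : Monotone fun t => f (max t 0) := fun s t hst =>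
  hf.strictMonoOn.monotoneOn (le_max_right s 0) (le_max_right t 0) (max_le_max_right 0 hst)

theorem continuous_comp_max (hf : IsSICC f ψ κ) : Continuous fun t => f (max t 0) :=
  hf.continuousOn.comp_continuous (continuous_id.max continuous_const) fun t => le_max_right t 0

theorem concaveOn_comp_max (hf : IsSICC f ψ κ) :
    ConcaveOn ℝ (Set.Ici 0) fun t => f (max t 0) :=
  hf.concaveOn.congr fun t ht => by simp only [max_eq_left (Set.mem_Ici.1 ht)]

theorem nonneg_comp_max (hf : IsSICC f ψ κ) (t : ℝ) : 0 ≤ f (max t 0) :=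
  hf.nonneg _ (le_max_right t 0)

theorem pos (hf : IsSICC f ψ κ) {t : ℝ} (ht : 0 < t) : 0 < f t := by
  have := hf.strictMonoOn (Set.mem_Ici.2 le_rfl) (Set.mem_Ici.2 ht.le) ht
  rwa [hf.map_zero] at this

end IsSICC

/-! ### Deterministic estimates -/

theorem prod_one_add_le_exp {b : ℕ → ℝ} (hb : ∀ n, 0 ≤ b n) {T : ℝ} {n : ℕ}
    (hT : ∑ i ∈ Finset.range n, b i ≤ T) : ∏ i ∈ Finset.range n, (1 + b i) ≤ Real.exp T :=
  calc ∏ i ∈ Finset.range n, (1 + b i) ≤ ∏ i ∈ Finset.range n, Real.exp (b i) :=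
        Finset.prod_le_prod (fun i _ => by linarith [hb i])
          fun i _ => by linarith [Real.add_one_le_exp (b i)]
    _ = Real.exp (∑ i ∈ Finset.range n, b i) := (Real.exp_sum _ _).symm
    _ ≤ Real.exp T := Real.exp_le_exp.2 hT

theorem one_le_prod_one_add {b : ℕ → ℝ} (hb : ∀ n, 0 ≤ b n) (n : ℕ) :
    1 ≤ ∏ i ∈ Finset.range n, (1 + b i) :=
  Finset.prod_induction _ (1 ≤ ·) (fun _ _ => one_le_mul_of_one_le_of_one_le) le_rfl
    fun i _ => by linarith [hb i]

/-- A discrete Gronwall inequality. -/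
theorem add_sum_le_prod_mul {e b w g : ℕ → ℝ} (hb : ∀ n, 0 ≤ b n) (hw : ∀ n, 0 ≤ w n)
    (hg : ∀ n, 0 ≤ g n) (hstep : ∀ n, e (n + 1) + w n ≤ (1 + b n) * e n + g n) (N : ℕ) :
    e N + ∑ i ∈ Finset.range N, w i
      ≤ (∏ i ∈ Finset.range N, (1 + b i)) * (e 0 + ∑ i ∈ Finset.range N, g i) := by
  induction N with
  | zero => simp
  | succ N ih =>
    rw [Finset.sum_range_succ, Finset.prod_range_succ, Finset.sum_range_succ]
    have hS : 0 ≤ ∑ i ∈ Finset.range N, w i := Finset.sum_nonneg fun i _ => hw i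
    have h1 := one_le_prod_one_add hb (N + 1)
    rw [Finset.prod_range_succ] at h1
    have h2 := mul_le_mul_of_nonneg_left ih (show 0 ≤ 1 + b N by linarith [hb N])
    have h3 := mul_le_mul_of_nonneg_right h1 (hg N)
    nlinarith [hstep N, mul_nonneg (hb N) hS]

/-- If `v ≥ t` on all of `s`, the weighted sum would be at least `b * t = K`. This extracts the good
index from a divergent weight sum. -/
theorem exists_lt_of_sum_mul_lt {a v : ℕ → ℝ} (ha : ∀ n, 0 ≤ a n) {s : Finset ℕ} {b t K : ℝ}
    (ht : 0 < t) (hb : b = K / t) (hsum : b ≤ ∑ n ∈ s, a n) (hK : ∑ n ∈ s, a n * v n < K) :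
    ∃ n ∈ s, v n < t := by
  by_contra! h
  have h1 : (∑ n ∈ s, a n) * t ≤ ∑ n ∈ s, a n * v n := by
    rw [Finset.sum_mul]
    exact Finset.sum_le_sum fun n hn => mul_le_mul_of_nonneg_left (h n hn) (ha n)
  have h2 := mul_le_mul_of_nonneg_right hsum ht.le
  rw [hb, div_mul_cancel₀ _ ht.ne'] at h2
  linarith

/-! ### Inner products of square-integrable random variables -/

theorem integrable_inner_of_memLp_two {Ω : Type*} {m0 : MeasurableSpace Ω} {μ : Measure Ω}
    {H : Type*} [NormedAddCommGroup H] [InnerProductSpace ℝ H]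
    {u y : Ω → H} (hu2 : MemLp u 2 μ) (hy2 : MemLp y 2 μ) :
    Integrable (fun ω => inner ℝ (u ω) (y ω)) μ :=
  (hu2.norm.integrable_mul hy2.norm).mono
    (hu2.aestronglyMeasurable.inner hy2.aestronglyMeasurable)
    (ae_of_all _ fun ω => by
      simpa using abs_real_inner_le_norm (u ω) (y ω))

theorem condExp_inner_left {Ω : Type*} {m m0 : MeasurableSpace Ω} {μ : Measure Ω}
    {H : Type*} [NormedAddCommGroup H] [InnerProductSpace ℝ H] [CompleteSpace H]
    [IsFiniteMeasure μ] {u y : Ω → H}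
    (hu : StronglyMeasurable[m] u) (hu2 : MemLp u 2 μ) (hy2 : MemLp y 2 μ) :
    μ[fun ω => inner ℝ (u ω) (y ω) | m] =ᵐ[μ] fun ω => inner ℝ (u ω) ((μ[y | m]) ω) :=
  condExp_bilin_of_stronglyMeasurable_left (innerSL ℝ) hu (integrable_inner_of_memLp_two hu2 hy2)
    (hy2.integrable one_le_two)

/-! ### The natural filtration of a stochastic approximation scheme -/

section Scheme

variable {Ω : Type*} {m m0 : MeasurableSpace Ω} {H : Type*} [MeasurableSpace H]

theorem rmSigma_mono (x y : ℕ → Ω → H) : Monotone (rmSigma x y) := fun _ _ h =>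
  biSup_mono fun _ hi => Finset.range_mono h hi

theorem rmSigma_le {x y : ℕ → Ω → H} (hx : ∀ n, Measurable (x n)) (hy : ∀ n, Measurable (y n))
    (n : ℕ) : rmSigma x y n ≤ m0 :=
  iSup₂_le fun i _ => sup_le (hx i).comap_le (hy i).comap_le

theorem measurable_rmSigma_left (x y : ℕ → Ω → H) {i n : ℕ} (h : i < n) :
    Measurable[rmSigma x y n] (x i) :=
  measurable_iff_comap_le.2 (le_sup_left.trans
    (le_iSup₂ (f := fun i (_ : i ∈ Finset.range n) =>
      (MeasurableSpace.comap (x i) inferInstance ⊔ MeasurableSpace.comap (y i) inferInstance))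
      i (Finset.mem_range.2 h)))

theorem measurable_rmSigma_right (x y : ℕ → Ω → H) {i n : ℕ} (h : i < n) :
    Measurable[rmSigma x y n] (y i) :=
  measurable_iff_comap_le.2 (le_sup_right.trans
    (le_iSup₂ (f := fun i (_ : i ∈ Finset.range n) =>
      (MeasurableSpace.comap (x i) inferInstance ⊔ MeasurableSpace.comap (y i) inferInstance))
      i (Finset.mem_range.2 h)))

variable [NormedAddCommGroup H] [SecondCountableTopology H] [BorelSpace H] {μ : Measure Ω}

/-! ### One step of the scheme -/

/-- Square-integrability is derived, not assumed: the conditional expectation takes values in `[0,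
∞]`, and integrating the bound shows that the second moment is finite. -/
theorem memLp_two_of_condLExp_le [IsFiniteMeasure μ]
    (hm : m ≤ m0) {y : Ω → H} (hy : Measurable y) {g : Ω → ℝ} (hg : Integrable g μ)
    (hbound : ∀ᵐ ω ∂μ, (μ⁻[fun ω' => ‖y ω'‖ₑ ^ 2 | m]) ω ≤ ENNReal.ofReal (g ω)) :
    MemLp y 2 μ := by
  rw [memLp_two_iff_integrable_sq_norm hy.aestronglyMeasurable]
  refine ⟨(hy.norm.pow_const 2).aestronglyMeasurable, ?_⟩
  have h1 : ∫⁻ ω, ‖y ω‖ₑ ^ 2 ∂μ < ⊤ := by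
    rw [← lintegral_condLExp hm]
    refine (lintegral_mono_ae hbound).trans_lt ?_
    exact (lintegral_ofReal_le_lintegral_enorm g).trans_lt hg.2
  simpa [HasFiniteIntegral, enorm_pow] using h1

theorem condExp_sq_norm_le_of_condLExp_le [IsFiniteMeasure μ]
    {y : Ω → H} (hy : Measurable y) (hy2 : MemLp y 2 μ) {g : Ω → ℝ}
    (hg0 : ∀ᵐ ω ∂μ, 0 ≤ g ω)
    (hbound : ∀ᵐ ω ∂μ, (μ⁻[fun ω' => ‖y ω'‖ₑ ^ 2 | m]) ω ≤ ENNReal.ofReal (g ω)) :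
    μ[fun ω => ‖y ω‖ ^ 2 | m] ≤ᵐ[μ] g := by
  have hfin : ∫⁻ ω, ‖y ω‖ₑ ^ 2 ∂μ ≠ ⊤ := by
    have := hy2.integrable_norm_pow (p := 2) (by norm_num)
    have := this.2
    simpa [HasFiniteIntegral, enorm_pow] using this.ne
  have h1 := toReal_condLExp m (f := fun ω => ‖y ω‖ₑ ^ 2) (by fun_prop) hfin
  simp only [ENNReal.toReal_pow, toReal_enorm] at h1
  filter_upwards [h1, hbound, hg0] with ω h2 h3 h4
  rw [← h2]
  exact ENNReal.toReal_le_of_le_ofReal h4 h3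

variable [InnerProductSpace ℝ H]

/-- The σ-algebra only sees indices below `n`, but `x n` is determined by the preceding pair, and `x
0` is constant. -/
theorem measurable_rmSigma_self {x y : ℕ → Ω → H} {a : ℕ → ℝ} {x₀ : H}
    (hx₀ : ∀ ω, x 0 ω = x₀) (hRM : ∀ n ω, x (n + 1) ω = x n ω - a n • y n ω) (n : ℕ) :
    Measurable[rmSigma x y n] (x n) := by
  cases n with
  | zero =>
    rw [show x 0 = fun _ => x₀ from funext hx₀]
    exact measurable_const
  | succ n =>
    rw [show x (n + 1) = fun ω => x n ω - a n • y n ω from funext (hRM n)]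
    exact (measurable_rmSigma_left x y n.lt_succ_self).sub
      ((measurable_rmSigma_right x y n.lt_succ_self).const_smul (a n))

theorem measurable_scheme {x y : ℕ → Ω → H} {a : ℕ → ℝ} {x₀ : H}
    (hy : ∀ n, Measurable (y n))
    (hx₀ : ∀ ω, x 0 ω = x₀) (hRM : ∀ n ω, x (n + 1) ω = x n ω - a n • y n ω) (n : ℕ) :
    Measurable (x n) := by
  induction n with
  | zero =>
    rw [show x 0 = fun _ => x₀ from funext hx₀]
    exact measurable_const
  | succ n ih =>
    rw [show x (n + 1) = fun ω => x n ω - a n • y n ω from funext (hRM n)]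
    exact ih.sub ((hy n).const_smul (a n))

variable [CompleteSpace H]

theorem condExp_sq_norm_sub_smul_le [IsFiniteMeasure μ]
    (hm : m ≤ m0) {u y : Ω → H} (hu : StronglyMeasurable[m] u) (hu2 : MemLp u 2 μ)
    (hy : Measurable y) (hy2 : MemLp y 2 μ) {c : ℝ} {D : Ω → ℝ} (hD : Integrable D μ)
    (hg0 : ∀ᵐ ω ∂μ, 0 ≤ c * ‖u ω‖ ^ 2 + D ω)
    (hbound : ∀ᵐ ω ∂μ,
      (μ⁻[fun ω' => ‖y ω'‖ₑ ^ 2 | m]) ω ≤ ENNReal.ofReal (c * ‖u ω‖ ^ 2 + D ω)) (a : ℝ) :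
    μ[fun ω => ‖u ω - a • y ω‖ ^ 2 | m] ≤ᵐ[μ] fun ω =>
      (1 + c * a ^ 2) * ‖u ω‖ ^ 2 - 2 * a * inner ℝ (u ω) ((μ[y | m]) ω)
        + a ^ 2 * (μ[D | m]) ω := by
  have hui : Integrable (fun ω => ‖u ω‖ ^ 2) μ := hu2.integrable_norm_pow (by norm_num)
  have hyi : Integrable (fun ω => ‖y ω‖ ^ 2) μ := hy2.integrable_norm_pow (by norm_num)
  have huy : Integrable (fun ω => inner ℝ (u ω) (y ω)) μ := integrable_inner_of_memLp_two hu2 hy2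
  have hum : StronglyMeasurable[m] fun ω => ‖u ω‖ ^ 2 := hu.norm.pow 2
  have hB := condExp_sq_norm_le_of_condLExp_le hy hy2 hg0 hbound
  -- `D` need not be `m`-measurable, so the bound is conditioned once more, replacing `D` by its
  -- conditional expectation.
  have hB' := condExp_mono (m := m) integrable_condExp ((hui.const_mul c).add hD) hB
  have e1 := condExp_condExp_of_le (μ := μ) (f := fun ω => ‖y ω‖ ^ 2) (le_refl m) hm
  have e2 := condExp_add (m := m) (hui.const_mul c) hD
  have e3 : μ[fun ω => c * ‖u ω‖ ^ 2 | m] = fun ω => c * ‖u ω‖ ^ 2 :=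
    condExp_of_stronglyMeasurable hm (hum.const_mul c) (hui.const_mul c)
  have e4 : μ[fun ω => ‖u ω‖ ^ 2 | m] = fun ω => ‖u ω‖ ^ 2 :=
    condExp_of_stronglyMeasurable hm hum hui
  have e5 : μ[fun ω => inner ℝ (u ω) (y ω) | m] =ᵐ[μ] fun ω => inner ℝ (u ω) ((μ[y | m]) ω) :=
    condExp_inner_left hu hu2 hy2
  have hexp : (fun ω => ‖u ω - a • y ω‖ ^ 2) = ((fun ω => ‖u ω‖ ^ 2)
      + (-(2 * a)) • fun ω => inner ℝ (u ω) (y ω)) + (a ^ 2) • fun ω => ‖y ω‖ ^ 2 := by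
    funext ω
    simp only [Pi.add_apply, Pi.smul_apply, smul_eq_mul]
    rw [norm_sub_sq_real, inner_smul_right, norm_smul, mul_pow, Real.norm_eq_abs, sq_abs]
    ring
  have e6 := condExp_add (m := m) (hui.add (huy.smul (-(2 * a)))) (hyi.smul (a ^ 2))
  have e7 := condExp_add (m := m) hui (huy.smul (-(2 * a)))
  have e8 := condExp_smul (μ := μ) (-(2 * a)) (fun ω => inner ℝ (u ω) (y ω)) m
  have e9 := condExp_smul (μ := μ) (a ^ 2) (fun ω => ‖y ω‖ ^ 2) m
  rw [hexp]
  filter_upwards [hB', e1, e2, e5, e6, e7, e8, e9] with ω h0 h1 h2 h5 h6 h7 h8 h9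
  rw [h6, Pi.add_apply, h7, Pi.add_apply, h8, h9, Pi.smul_apply, Pi.smul_apply, h5, e4]
  have h2' : (μ[fun ω => c * ‖u ω‖ ^ 2 + D ω | m]) ω = c * ‖u ω‖ ^ 2 + (μ[D | m]) ω := by
    have := h2
    rw [Pi.add_apply, e3] at this
    exact this
  have h0' : (μ[fun ω => ‖y ω‖ ^ 2 | m]) ω ≤ c * ‖u ω‖ ^ 2 + (μ[D | m]) ω := by
    rw [← h2', ← h1]
    exact h0
  simp only [smul_eq_mul]
  nlinarith [mul_le_mul_of_nonneg_left h0' (sq_nonneg a)]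

end Scheme

/-! ### Square-integrability along the scheme -/

section SchemeBounds

variable {Ω : Type*} {m0 : MeasurableSpace Ω} {μ : Measure Ω}
  {H : Type*} [MeasurableSpace H] [NormedAddCommGroup H] [InnerProductSpace ℝ H]
  [SecondCountableTopology H] [BorelSpace H]

/-- The two claims feed each other: `x n - z` in L² gives `y n` in L² through the conditional bound,
and both give `x (n + 1) - z` in L². -/
theorem memLp_two_scheme [IsProbabilityMeasure μ] {x y : ℕ → Ω → H} {a : ℕ → ℝ} {x₀ z : H}
    (hy : ∀ n, Measurable (y n)) (hx₀ : ∀ ω, x 0 ω = x₀)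
    (hRM : ∀ n ω, x (n + 1) ω = x n ω - a n • y n ω) {c : ℝ} {D : ℕ → Ω → ℝ}
    (hD_int : ∀ n, Integrable (D n) μ)
    (h_bounded : ∀ n, ∀ᵐ ω ∂μ,
      (μ⁻[fun ω' => ‖y n ω'‖ₑ ^ 2 | rmSigma x y n]) ω
        ≤ ENNReal.ofReal (c * ‖x n ω - z‖ ^ 2 + D n ω)) (n : ℕ) :
    MemLp (fun ω => x n ω - z) 2 μ ∧ MemLp (y n) 2 μ := by
  have hxm := measurable_scheme hy hx₀ hRM
  have hy2 : ∀ n, MemLp (fun ω => x n ω - z) 2 μ → MemLp (y n) 2 μ := fun n h =>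
    memLp_two_of_condLExp_le (rmSigma_le hxm hy n) (hy n)
      (((h.integrable_norm_pow (p := 2) (by norm_num)).const_mul c).add (hD_int n)) (h_bounded n)
  have hx2 : ∀ n, MemLp (fun ω => x n ω - z) 2 μ := by
    intro n
    induction n with
    | zero => simpa only [hx₀] using memLp_const (x₀ - z)
    | succ n ih =>
      have : (fun ω => x (n + 1) ω - z) = (fun ω => x n ω - z) - a n • y n := by
        funext ω
        simp only [hRM, Pi.sub_apply, Pi.smul_apply]
        abel
      rw [this]
      exact ih.sub ((hy2 n ih).const_smul (a n))
  exact ⟨hx2 n, hy2 n (hx2 n)⟩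

end SchemeBounds

/-! ### Tail sums and almost sure convergence -/

theorem sum_Ico_le_tsum_add {g : ℕ → ℝ} (hg : ∀ n, 0 ≤ g n) (hs : Summable g) {k m : ℕ}
    (hkm : k ≤ m) (N : ℕ) : ∑ i ∈ Finset.Ico m N, g i ≤ ∑' n, g (k + n) := by
  refine (Finset.sum_le_sum_of_subset_of_nonneg (Finset.Ico_subset_Ico_left hkm)
    fun i _ _ => hg i).trans ?_
  rw [Finset.sum_Ico_eq_sum_range]
  refine Summable.sum_le_tsum _ (fun i _ => hg _) ?_
  simpa only [add_comm k] using (summable_nat_add_iff k).2 hs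

/-- A maximal bound at a fixed level for every tail yields almost sure convergence to zero. -/
theorem ae_tendsto_zero_of_tail_bound {Ω : Type*} {m0 : MeasurableSpace Ω} {μ : Measure Ω}
    {g : ℕ → Ω → ℝ} (hg : ∀ n ω, 0 ≤ g n ω)
    (h : ∀ lam ε : ℝ, 0 < lam → 0 < ε →
      ∃ N, μ {ω | ∃ n, N ≤ n ∧ ε ≤ g n ω} < ENNReal.ofReal lam) :
    ∀ᵐ ω ∂μ, Tendsto (fun n => g n ω) atTop (𝓝 0) := by
  have h1 : ∀ k : ℕ, ∀ᵐ ω ∂μ, ∃ N, ∀ n, N ≤ n → g n ω < 1 / ((k : ℝ) + 1) := by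
    intro k
    rw [ae_iff]
    refine le_antisymm (ENNReal.le_of_forall_pos_le_add fun δ hδ _ => ?_) bot_le
    obtain ⟨N, hN⟩ := h δ (1 / ((k : ℝ) + 1)) (by exact_mod_cast hδ) (by positivity)
    rw [zero_add, ← ENNReal.ofReal_coe_nnreal]
    refine le_trans (measure_mono fun ω hω => ?_) hN.le
    simp only [Set.mem_ofPred_eq, not_exists, not_forall, not_lt] at hω ⊢
    obtain ⟨n, hn, h'⟩ := hω N
    exact ⟨n, hn, h'⟩
  filter_upwards [ae_all_iff.2 h1] with ω hω
  rw [Metric.tendsto_atTop]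
  intro ε hε
  obtain ⟨k, hk⟩ := exists_nat_one_div_lt hε
  obtain ⟨N, hN⟩ := hω k
  refine ⟨N, fun n hn => ?_⟩
  rw [Real.dist_eq, sub_zero, abs_of_nonneg (hg n ω)]
  exact (hN n hn).trans hk

/-! ### Rates of convergence in mean and almost surely -/

theorem theorem6p1
    {Ω : Type*} [MeasurableSpace Ω] (μ : Measure Ω) [IsProbabilityMeasure μ]
    {H : Type*} [NormedAddCommGroup H] [InnerProductSpace ℝ H] [CompleteSpace H]
    [TopologicalSpace.SeparableSpace H] [MeasurableSpace H] [BorelSpace H]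
    -- the scheme
    (x y : ℕ → Ω → H) (a : ℕ → ℝ) (x₀ z : H)
    (hy : ∀ n, Measurable (y n))
    (ha : ∀ n, 0 ≤ a n)
    (hx₀ : ∀ ω, x 0 ω = x₀)
    (hRM : ∀ n ω, x (n + 1) ω = x n ω - a n • y n ω)
    (L : ℝ) (hL : 0 < L) (hL₀ : ‖x₀ - z‖ ^ 2 < L)
    -- (i)
    (c d : ℝ) (hc : 0 < c) (hd : 0 < d) (D : ℕ → Ω → ℝ)
    (hD_nonneg : ∀ n, ∀ᵐ ω ∂μ, 0 ≤ D n ω)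
    (hD_int : ∀ n, Integrable (D n) μ)
    (hD_bound : ∀ n, ∫ ω, D n ω ∂μ ≤ d)
    (h_bounded : ∀ n, ∀ᵐ ω ∂μ,
      (μ⁻[fun ω' => ‖y n ω'‖ₑ ^ 2 | rmSigma x y n]) ω
        ≤ ENNReal.ofReal (c * ‖x n ω - z‖ ^ 2 + D n ω))
    -- (ii)
    (h_pos : ∀ n, ∀ᵐ ω ∂μ, 0 ≤ inner ℝ (x n ω - z) ((μ[y n | rmSigma x y n]) ω))
    -- (iii)
    (f ψ κ : ℝ → ℝ) (hf : IsSICC f ψ κ)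
    (τ : ℝ → ℝ) (hτ_pos : ∀ ε, 0 < ε → 0 < τ ε)
    (hτ : ∀ ε, 0 < ε → ∀ n,
      ∫ ω, inner ℝ (x n ω - z) ((μ[y n | rmSigma x y n]) ω) ∂μ < τ ε →
        ∫ ω, f (‖x n ω - z‖ ^ 2) ∂μ < ε)
    -- (iv)
    (θ : ℕ → ℝ → ℕ)
    (hθ : ∀ (k : ℕ) (b : ℝ), 0 < b → b ≤ ∑ n ∈ Finset.Icc k (θ k b), a n)
    (M : ℝ) (ha_summable : Summable (fun n => a n ^ 2)) (hM : ∑' n, a n ^ 2 < M)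
    (χ : ℝ → ℕ) (hχ : ∀ ε, 0 < ε → ∑' n, a (χ ε + n) ^ 2 < ε) :
    -- convergence in mean, with rate
    (∀ n, Integrable (fun ω => f (‖x n ω - z‖ ^ 2)) μ) ∧
    Tendsto (fun n => ∫ ω, f (‖x n ω - z‖ ^ 2) ∂μ) atTop (𝓝 0) ∧
    (∀ ε, 0 < ε → ∀ n, rmRate θ χ τ ψ κ c d L M ε ≤ n →
      ∫ ω, f (‖x n ω - z‖ ^ 2) ∂μ < ε) ∧
    -- almost sure convergence, with rate
    (∀ᵐ ω ∂μ, Tendsto (fun n => x n ω) atTop (𝓝 z)) ∧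
    (∀ lam ε, 0 < lam → 0 < ε →
      μ {ω | ∃ n, rmRate θ χ τ ψ κ c d L M (lam * f (ε ^ 2)) ≤ n ∧ ε ≤ ‖x n ω - z‖}
        < ENNReal.ofReal lam) := by
  have : SecondCountableTopology H := UniformSpace.secondCountable_of_separable H
  have hxm := measurable_scheme hy hx₀ hRM
  have hle := rmSigma_le hxm hy
  have hL2 := memLp_two_scheme (z := z) hy hx₀ hRM hD_int h_bounded
  have hadapt : ∀ n, StronglyMeasurable[rmSigma x y n] fun ω => x n ω - z := fun n =>
    ((measurable_rmSigma_self hx₀ hRM n).sub_const z).stronglyMeasurable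
  have hXi : ∀ n, Integrable (fun ω => ‖x n ω - z‖ ^ 2) μ := fun n =>
    (hL2 n).1.integrable_norm_pow (p := 2) (by norm_num)
  have hVi : ∀ n, Integrable
      (fun ω => inner ℝ (x n ω - z) ((μ[y n | rmSigma x y n]) ω)) μ := fun n =>
    integrable_condExp.congr (condExp_inner_left (hadapt n) (hL2 n).1 (hL2 n).2)
  have hstep : ∀ n, μ[fun ω => ‖x (n + 1) ω - z‖ ^ 2 | rmSigma x y n] ≤ᵐ[μ] fun ω =>
      (1 + c * a n ^ 2) * ‖x n ω - z‖ ^ 2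
        - 2 * a n * inner ℝ (x n ω - z) ((μ[y n | rmSigma x y n]) ω)
        + a n ^ 2 * (μ[D n | rmSigma x y n]) ω := by
    intro n
    have hrec : (fun ω => ‖x (n + 1) ω - z‖ ^ 2) = fun ω => ‖(x n ω - z) - a n • y n ω‖ ^ 2 := by
      funext ω
      rw [hRM, sub_right_comm]
    rw [hrec]
    refine condExp_sq_norm_sub_smul_le (hle n) (hadapt n) (hL2 n).1 (hy n) (hL2 n).2 (hD_int n) ?_
      (h_bounded n) (a n)
    filter_upwards [hD_nonneg n] with ω h
    positivity
  -- deterministic consequences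
  have hb0 : ∀ n, 0 ≤ c * a n ^ 2 := fun n => by positivity
  have ha2 : ∀ n, ∑ i ∈ Finset.range n, a i ^ 2 ≤ M := fun n =>
    (ha_summable.sum_le_tsum _ fun i _ => sq_nonneg _).trans hM.le
  have hM0 : 0 < M := (tsum_nonneg fun n => sq_nonneg (a n)).trans_lt hM
  set P : ℕ → ℝ := fun n => ∏ i ∈ Finset.range n, (1 + c * a i ^ 2) with hP
  have hP1 : ∀ n, 1 ≤ P n := one_le_prod_one_add hb0
  have hPexp : ∀ n, P n ≤ Real.exp (c * M) := fun n => by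
    refine prod_one_add_le_exp hb0 ?_
    rw [← Finset.mul_sum]
    exact mul_le_mul_of_nonneg_left (ha2 n) hc.le
  set v : ℕ → ℝ := fun n => ∫ ω, inner ℝ (x n ω - z) ((μ[y n | rmSigma x y n]) ω) ∂μ with hv
  have hv0 : ∀ n, 0 ≤ v n := fun n => integral_nonneg_of_ae (h_pos n)
  have hmean : ∀ n, ∫ ω, ‖x (n + 1) ω - z‖ ^ 2 ∂μ + 2 * (a n * v n)
      ≤ (1 + c * a n ^ 2) * ∫ ω, ‖x n ω - z‖ ^ 2 ∂μ + a n ^ 2 * d := by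
    intro n
    have hi1 := (hXi n).const_mul (1 + c * a n ^ 2)
    have hi2 := (hVi n).const_mul (2 * a n)
    have hi3 : Integrable (fun ω => a n ^ 2 * (μ[D n | rmSigma x y n]) ω) μ :=
      integrable_condExp.const_mul _
    have h1 := integral_mono_ae integrable_condExp ((hi1.sub hi2).add hi3) (hstep n)
    have h2 : ∫ ω, ((1 + c * a n ^ 2) * ‖x n ω - z‖ ^ 2
        - 2 * a n * inner ℝ (x n ω - z) ((μ[y n | rmSigma x y n]) ω)
        + a n ^ 2 * (μ[D n | rmSigma x y n]) ω) ∂μ = (1 + c * a n ^ 2) * ∫ ω, ‖x n ω - z‖ ^ 2 ∂μ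
          - 2 * a n * v n + a n ^ 2 * ∫ ω, D n ω ∂μ := by
      have e1 := integral_add (hi1.sub hi2) hi3
      simp only [Pi.sub_apply] at e1
      rw [e1, integral_sub hi1 hi2, integral_const_mul, integral_const_mul, integral_const_mul,
        integral_condExp (hle n)]
    rw [integral_condExp (hle n)] at h1
    have h3 := mul_le_mul_of_nonneg_left (hD_bound n) (sq_nonneg (a n))
    have h4 := h1.trans_eq h2
    linarith
  -- Gronwall with the nonnegative term E X_N dropped; strictness comes from `hL₀`.
  have hsum : ∀ N, 2 * ∑ i ∈ Finset.range N, a i * v i < Real.exp (c * M) * (L + d * M) := by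
    intro N
    have h1 := add_sum_le_prod_mul (e := fun n => ∫ ω, ‖x n ω - z‖ ^ 2 ∂μ) hb0
      (fun n => mul_nonneg zero_le_two (mul_nonneg (ha n) (hv0 n)))
      (fun n => mul_nonneg (sq_nonneg (a n)) hd.le) hmean N
    have h2 : ∫ ω, ‖x 0 ω - z‖ ^ 2 ∂μ = ‖x₀ - z‖ ^ 2 := by simp [hx₀]
    have h3 : 0 ≤ ∫ ω, ‖x N ω - z‖ ^ 2 ∂μ := integral_nonneg fun ω => sq_nonneg _
    simp only [h2, ← Finset.mul_sum, ← Finset.sum_mul] at h1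
    have h4 : (∑ i ∈ Finset.range N, a i ^ 2) * d ≤ d * M := by
      rw [mul_comm d]
      exact mul_le_mul_of_nonneg_right (ha2 N) hd.le
    have h5 : 0 ≤ (∑ i ∈ Finset.range N, a i ^ 2) * d :=
      mul_nonneg (Finset.sum_nonneg fun i _ => sq_nonneg _) hd.le
    calc 2 * ∑ i ∈ Finset.range N, a i * v i
        ≤ P N * (‖x₀ - z‖ ^ 2 + (∑ i ∈ Finset.range N, a i ^ 2) * d) := by linarith
      _ ≤ Real.exp (c * M) * (‖x₀ - z‖ ^ 2 + (∑ i ∈ Finset.range N, a i ^ 2) * d) := by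
          gcongr
          exact hPexp N
      _ < _ := mul_lt_mul_of_pos_left (by linarith) (Real.exp_pos _)
  -- the normalized almost supermartingale
  set W : ℕ → Ω → ℝ := fun n ω => (P n)⁻¹ * ‖x n ω - z‖ ^ 2 with hW
  set B : ℕ → Ω → ℝ := fun n ω => a n ^ 2 * D n ω with hB
  have hWstep : ∀ n, μ[W (n + 1) | rmSigma x y n] ≤ᵐ[μ] W n + μ[B n | rmSigma x y n] := by
    intro n
    have e1 := condExp_smul (μ := μ) (P (n + 1))⁻¹ (fun ω => ‖x (n + 1) ω - z‖ ^ 2)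
      (rmSigma x y n)
    have e2 := condExp_smul (μ := μ) (a n ^ 2) (D n) (rmSigma x y n)
    have hDc : 0 ≤ᵐ[μ] μ[D n | rmSigma x y n] := condExp_nonneg (hD_nonneg n)
    filter_upwards [e1, e2, hstep n, h_pos n, hDc] with ω h1 h2 h3 h4 h5
    have hPs : P (n + 1) = P n * (1 + c * a n ^ 2) := Finset.prod_range_succ _ _
    have hPn : 0 < P n := zero_lt_one.trans_le (hP1 n)
    have hq : 0 < 1 + c * a n ^ 2 := by linarith [hb0 n]
    have h6 : (μ[fun ω => ‖x (n + 1) ω - z‖ ^ 2 | rmSigma x y n]) ω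
        ≤ (1 + c * a n ^ 2) * ‖x n ω - z‖ ^ 2 + a n ^ 2 * (μ[D n | rmSigma x y n]) ω := by
      have := mul_nonneg (mul_nonneg zero_le_two (ha n)) h4
      linarith
    calc (μ[W (n + 1) | rmSigma x y n]) ω
        = (P (n + 1))⁻¹ * (μ[fun ω => ‖x (n + 1) ω - z‖ ^ 2 | rmSigma x y n]) ω := h1
      _ ≤ (P (n + 1))⁻¹ * ((1 + c * a n ^ 2) * ‖x n ω - z‖ ^ 2
            + a n ^ 2 * (μ[D n | rmSigma x y n]) ω) :=
          mul_le_mul_of_nonneg_left h6 (inv_nonneg.2 (zero_le_one.trans (hP1 _)))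
      _ = W n ω + (P (n + 1))⁻¹ * (a n ^ 2 * (μ[D n | rmSigma x y n]) ω) := by
          simp only [hW]
          rw [mul_add, hPs]
          field_simp
      _ ≤ W n ω + a n ^ 2 * (μ[D n | rmSigma x y n]) ω := by
          refine add_le_add_right ?_ _
          exact mul_le_of_le_one_left (mul_nonneg (sq_nonneg _) h5) (inv_le_one_of_one_le₀ (hP1 _))
      _ = W n ω + (μ[B n | rmSigma x y n]) ω := by
          rw [show (μ[B n | rmSigma x y n]) ω = a n ^ 2 * (μ[D n | rmSigma x y n]) ω from h2]
  set p : ℝ := ψ (Real.exp (-(c * M))) with hp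
  have hexp1 : Real.exp (-(c * M)) ≤ 1 := Real.exp_le_one_iff.2 (by nlinarith)
  have hp0 : 0 < p := hf.psi_pos _ ⟨Real.exp_pos _, hexp1⟩
  have hW0 : ∀ n ω, 0 ≤ W n ω := fun n ω =>
    mul_nonneg (inv_nonneg.2 (zero_le_one.trans (hP1 n))) (sq_nonneg _)
  have hWle : ∀ n ω, W n ω ≤ ‖x n ω - z‖ ^ 2 := fun n ω =>
    mul_le_of_le_one_left (sq_nonneg _) (inv_le_one_of_one_le₀ (hP1 n))
  -- Undoing the normalization: `P n ≤ exp (c * M)` gives e^{-cM} X_n ≤ W_n, and the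
  -- supermultiplicativity of `f` moves the constant outside as `p`.
  have hpW : ∀ n ω, p * f (‖x n ω - z‖ ^ 2) ≤ f (max (W n ω) 0) := by
    intro n ω
    rw [mul_comm]
    refine (hf.supermul _ (sq_nonneg _) _ ⟨(Real.exp_pos _).le, hexp1⟩).trans ?_
    rw [max_eq_left (hW0 n ω)]
    refine hf.strictMonoOn.monotoneOn (mul_nonneg (sq_nonneg _) (Real.exp_pos _).le) (hW0 n ω) ?_
    rw [mul_comm, Real.exp_neg]
    exact mul_le_mul_of_nonneg_right
      (inv_anti₀ (zero_lt_one.trans_le (hP1 n)) (hPexp n)) (sq_nonneg _)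
  have hfX : ∀ n, Integrable (fun ω => f (‖x n ω - z‖ ^ 2)) μ := by
    intro n
    have := (hXi n).concave_comp hf.concaveOn_comp_max hf.monotone_comp_max
      hf.continuous_comp_max hf.nonneg_comp_max
    simpa only [max_eq_left (sq_nonneg _)] using this
  have hWi : ∀ n, Integrable (W n) μ := fun n => (hXi n).const_mul _
  have hfW : ∀ n, Integrable (fun ω => f (max (W n ω) 0)) μ := fun n =>
    (hWi n).concave_comp hf.concaveOn_comp_max hf.monotone_comp_max
      hf.continuous_comp_max hf.nonneg_comp_max
  -- One number `S`, namely E f(W_m) + f(β), bounds both the means and the maximal probabilities, so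
  -- a single rate serves both claims.
  have hcore : ∀ ε, 0 < ε → ∃ S < p * ε,
      (∀ n, rmRate θ χ τ ψ κ c d L M ε ≤ n → p * ∫ ω, f (‖x n ω - z‖ ^ 2) ∂μ ≤ S) ∧
      ∀ t, 0 ≤ t → p * t * μ.real {ω | ∃ n, rmRate θ χ τ ψ κ c d L M ε ≤ n ∧
        t ≤ f (‖x n ω - z‖ ^ 2)} ≤ S := by
    intro ε hε
    set K₁ : ℝ := 1 / 2 * p with hK₁
    have hKε : 0 < K₁ * ε := by positivity
    set k := χ (κ (K₁ * ε) / d) with hk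
    set K₂ : ℝ := Real.exp (c * M) * (L + d * M) with hK₂
    have hK₂0 : 0 < K₂ := by positivity
    have hrate : rmRate θ χ τ ψ κ c d L M ε = θ k (K₂ / τ (K₁ * ε)) := rfl
    rw [hrate]
    set r := θ k (K₂ / τ (K₁ * ε)) with hr
    -- The index `m` is not explicit; the rate is the right end of the window that contains it. The
    -- factor 2 in `hsum` is not needed here.
    obtain ⟨m, hmI, hm⟩ : ∃ m ∈ Finset.Icc k r, v m < τ (K₁ * ε) := by
      refine exists_lt_of_sum_mul_lt ha (hτ_pos _ hKε) rfl
        (hθ k _ (div_pos hK₂0 (hτ_pos _ hKε))) ?_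
      have h1 : ∑ n ∈ Finset.Icc k r, a n * v n ≤ ∑ n ∈ Finset.range (r + 1), a n * v n :=
        Finset.sum_le_sum_of_subset_of_nonneg
          (fun i hi => Finset.mem_range.2 (Nat.lt_succ_of_le (Finset.mem_Icc.1 hi).2))
          fun i _ _ => mul_nonneg (ha i) (hv0 i)
      have h2 : 0 ≤ ∑ n ∈ Finset.range (r + 1), a n * v n :=
        Finset.sum_nonneg fun i _ => mul_nonneg (ha i) (hv0 i)
      linarith [hsum (r + 1)]
    obtain ⟨hkm, hmr⟩ := Finset.mem_Icc.1 hmI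
    have hfm := hτ _ hKε m hm
    -- The tail starts at the known `k` rather than at `m`; evaluating `χ` at `κ (K₁ * ε) / d` makes
    -- it smaller than `κ (K₁ * ε)` after multiplication by `d`.
    set β : ℝ := (∑' n, a (k + n) ^ 2) * d with hβ
    have hβ0 : 0 ≤ β := mul_nonneg (tsum_nonneg fun n => sq_nonneg _) hd.le
    have hβκ : β < κ (K₁ * ε) := (lt_div_iff₀ hd).1 (hχ _ (div_pos (hf.kappa_pos _ hKε) hd))
    have hfβ : f β < K₁ * ε := hf.kappa_spec _ hKε _ hβ0 hβκ
    have hBsum : ∀ N, ∑ i ∈ Finset.Ico m N, ∫ ω, B i ω ∂μ ≤ β := by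
      intro N
      refine le_trans (Finset.sum_le_sum (g := fun i => a i ^ 2 * d) fun i _ => ?_) ?_
      · simp only [hB]
        rw [integral_const_mul]
        exact mul_le_mul_of_nonneg_left (hD_bound i) (sq_nonneg _)
      · rw [← Finset.sum_mul]
        exact mul_le_mul_of_nonneg_right
          (sum_Ico_le_tsum_add (fun n => sq_nonneg (a n)) ha_summable hkm N) hd.le
    obtain ⟨hA1, hA2⟩ := almost_supermartingale_concave_bounds (μ := μ)
      hf.concaveOn_comp_max hf.monotone_comp_max hf.continuous_comp_max hf.nonneg_comp_max
      (rmSigma x y) (rmSigma_mono x y) hle (W := W) (B := B)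
      (fun n => ((hadapt n).norm.pow 2).const_mul _) hWi hW0 (fun n => (hD_int n).const_mul _)
      (fun n => by
        filter_upwards [hD_nonneg n] with ω h
        exact mul_nonneg (sq_nonneg _) h)
      hWstep m hBsum
    refine ⟨_, ?_, fun n hn => le_trans ?_ (hA1 n (hmr.trans hn)),
      fun t ht => le_trans ?_ (hA2 (p * t) (mul_nonneg hp0.le ht))⟩
    · have h1 : ∫ ω, f (max (W m ω) 0) ∂μ ≤ ∫ ω, f (‖x m ω - z‖ ^ 2) ∂μ := by
        refine integral_mono (hfW m) (hfX m) fun ω => ?_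
        simp only [max_eq_left (hW0 m ω)]
        exact hf.strictMonoOn.monotoneOn (hW0 m ω) (Set.mem_Ici.2 (sq_nonneg _)) (hWle m ω)
      -- The 1/2 in K₁ splits `p * ε` equally between the value at time `m` and the future errors.
      have h2 : K₁ * ε + K₁ * ε = p * ε := by rw [hK₁]; ring
      rw [max_eq_left hβ0]
      linarith
    · rw [← integral_const_mul]
      exact integral_mono ((hfX n).const_mul p) (hfW n) (hpW n)
    · refine mul_le_mul_of_nonneg_left ?_ (mul_nonneg hp0.le ht)
      refine measureReal_mono ?_
      rintro ω ⟨n, hn, h⟩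
      exact ⟨n, hmr.trans hn, (mul_le_mul_of_nonneg_left h hp0.le).trans (hpW n ω)⟩
  have hrateMean : ∀ ε, 0 < ε → ∀ n, rmRate θ χ τ ψ κ c d L M ε ≤ n →
      ∫ ω, f (‖x n ω - z‖ ^ 2) ∂μ < ε := by
    intro ε hε n hn
    obtain ⟨S, hS, h1, -⟩ := hcore ε hε
    exact lt_of_mul_lt_mul_left ((h1 n hn).trans_lt hS) hp0.le
  have hrateAS : ∀ lam ε, 0 < lam → 0 < ε →
      μ {ω | ∃ n, rmRate θ χ τ ψ κ c d L M (lam * f (ε ^ 2)) ≤ n ∧ ε ≤ ‖x n ω - z‖}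
        < ENNReal.ofReal lam := by
    intro lam ε hlam hε
    have hfε : 0 < f (ε ^ 2) := hf.pos (by positivity)
    -- With level t = f(ε²) and accuracy λ f(ε²), the factor p f(ε²) cancels and leaves probability
    -- below λ.
    obtain ⟨S, hS, -, h2⟩ := hcore (lam * f (ε ^ 2)) (by positivity)
    have h3 := (h2 _ hfε.le).trans_lt hS
    have h4 : μ.real {ω | ∃ n, rmRate θ χ τ ψ κ c d L M (lam * f (ε ^ 2)) ≤ n ∧
        f (ε ^ 2) ≤ f (‖x n ω - z‖ ^ 2)} < lam := by
      have h5 : 0 < p * f (ε ^ 2) := by positivity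
      refine lt_of_mul_lt_mul_left (h3.trans_eq ?_) h5.le
      ring
    refine lt_of_le_of_lt (measure_mono ?_)
      ((ENNReal.lt_ofReal_iff_toReal_lt (measure_ne_top μ _)).2 h4)
    rintro ω ⟨n, hn, h⟩
    exact ⟨n, hn, hf.strictMonoOn.monotoneOn (sq_nonneg ε) (Set.mem_Ici.2 (sq_nonneg _))
      (pow_le_pow_left₀ hε.le h 2)⟩
  refine ⟨hfX, ?_, hrateMean, ?_, hrateAS⟩
  · rw [Metric.tendsto_atTop]
    intro ε hε
    refine ⟨rmRate θ χ τ ψ κ c d L M ε, fun n hn => ?_⟩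
    rw [Real.dist_eq, sub_zero, abs_of_nonneg (integral_nonneg fun ω => hf.nonneg _ (sq_nonneg _))]
    exact hrateMean ε hε n hn
  · filter_upwards [ae_tendsto_zero_of_tail_bound (fun n ω => norm_nonneg (x n ω - z))
      fun lam ε hlam hε => ⟨_, hrateAS lam ε hlam hε⟩] with ω h
    exact tendsto_iff_norm_sub_tendsto_zero.2 h
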